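/- Let $(\mathsf X,\mathcal X)$ and $(\Theta,\mathcal T)$ be measurable spaces with countably generated $\sigma$-fields. Let $\{P_\theta,\theta\in\Theta\}$ be a family of Markov transition kernels on $(\mathsf X,\mathcal X)$ such that $\theta\mapsto P_\theta(x,A)$ is measurable for all $x\in\mathsf X$, $A\in\mathcal X$, and let $\{\bar P(n;\cdot,\cdot),n\ge 0\}$ be Markov transition kernels on $(\mathsf X\times\Theta,\mathcal X\otimes\mathcal T)$ with $\bar P(n;(x,\theta);A\times\Theta)=P_\theta(x,A)$ for all $n,x,\theta$ and $A\in\mathcal X$. For $l\ge 0$, let $\mathbb P^{(l)}_{x,\theta}$ be the law, on the canonical space, of the non-homogeneous Markov chain $(X_n,\theta_n)_{n\ge0}$ started at $(x,\theta)$ whose transition from time $n$ to time $n+1$ is $\bar P(l+n;\cdot,\cdot)$. For probability measures $\xi_1$ on $\mathsf X$ and $\xi_2$ on $\Theta$, let $\mathbb P_{\xi_1,\xi_2}$ be the law of the chain with transition $\bar P(n;\cdot,\cdot)$ from time $n$ to time $n+1$ and initial distribution $\xi_1\otimes\xi_2$. Write $\|\mu\|_{\mathrm{TV}}=\sup\{|\mu(f)|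 : f \text{ measurable},\ |f|\le 1\}$ and $D(\theta,\theta')=\sup_{x\in\mathsf X}\|P_\theta(x,\cdot)-P_{\theta'}(x,\cdot)\|_{\mathrm{TV}}$. Assume that there is a probability measure $\pi$ on $\mathsf X$ with $$\lim_{n\to\infty}\ \sup_{(x,\theta)\in\mathsf X\times\Theta}\|P_\theta^n(x,\cdot)-\pi\|_{\mathrm{TV}}=0,$$ and that for every $\epsilon>0$ $$\lim_{n\to\infty}\ \sup_{l\ge0}\ \sup_{(x,\theta)\in\mathsf X\times\Theta}\mathbb P^{(l)}_{x,\theta}\bigl(D(\theta_n,\theta_{n-1})\ge\epsilon\bigr)=0$$ (if the event $\{D(\theta_n,\theta_{n-1})\ge\epsilon\}$ is not measurable, its probability is understood as outer probability). Then for every bounded measurable $f:\mathsf X\to\mathbb R$ and all probability measures $\xi_1$ on $\mathsf X$ and $\xi_2$ on $\Theta$, $$\lim_{n\to\infty}\frac1n\sum_{k=1}^n f(X_k)=\pi(f)\qquad \mathbb P_{\xi_1,\xi_2}\text{-almost surely.}$$ -/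

import Mathlib

open MeasureTheory ProbabilityTheory Filter Topology
open scoped ENNReal

namespace AdaptiveChain

/-- The total variation norm of `μ - ν`, that is the supremum of `|μ(f) - ν(f)|` over all measurable
`f` with `|f| ≤ 1`, as an extended nonnegative number. It is meant for finite measures (it takes
values in `[0, 2]` on probability measures). -/
noncomputable def tvNorm {T : Type*} [MeasurableSpace T] (μ ν : Measure T) : ℝ≥0∞ :=
  ⨆ (f : T → ℝ) (_ : Measurable f) (_ : ∀ x, |f x| ≤ 1),
    ENNReal.ofReal |∫ x, f x ∂μ - ∫ x, f x ∂ν|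

/-- `D(θ, θ') = sup_x ‖P_θ(x, ·) - P_θ'(x, ·)‖_TV`. -/
noncomputable def kernelDist {X Θ : Type*} [MeasurableSpace X] (P : Θ → Kernel X X)
    (θ θ' : Θ) : ℝ≥0∞ :=
  ⨆ x : X, tvNorm (P θ x) (P θ' x)

/-- A transition kernel `K` on `Z`, viewed as a kernel from the histories `(z_0, …, z_n)` that
looks at the current state `z_n` only. -/
noncomputable def historyKernel {Z : Type*} [MeasurableSpace Z] (K : Kernel Z Z) (n : ℕ) :
    Kernel (Π _ : Finset.Iic n, Z) Z :=
  K.comap (fun h => h ⟨n, Finset.mem_Iic.2 le_rfl⟩) (measurable_pi_apply _)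

instance {Z : Type*} [MeasurableSpace Z] (K : Kernel Z Z) [IsMarkovKernel K] (n : ℕ) :
    IsMarkovKernel (historyKernel K n) := by
  unfold historyKernel; infer_instance

/-- The law on the canonical space `ℕ → Z` of the non-homogeneous Markov chain `(Z_n)` with initial
distribution `μ` whose transition from time `n` to time `n + 1` is governed by `K n`. -/
noncomputable def chainLaw {Z : Type*} [MeasurableSpace Z] (μ : Measure Z)
    (K : ℕ → Kernel Z Z) [∀ n, IsMarkovKernel (K n)] : Measure (ℕ → Z) :=
  Kernel.trajMeasure (X := fun _ => Z) μ (fun n => historyKernel (K n) n)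

end AdaptiveChain

namespace AdaptiveChain

/-! Scale to `|f| ≤ 1`. Some `N` makes the conditional mean of `f(X_{k+N})` given the history up to
time `k` lie within `ε` of `π(f)`, uniformly in `k` and the current state
(`exists_abs_expectAfter_sub_le`): wait `n` steps until adaptation is slow, then compare the next
`M` steps with the chain whose parameter is frozen at time `n`, which is ergodic.

The errors `Y_k = f(X_{k+N}) - E[f(X_{k+N}) | F_k]` are bounded, and orthogonal at lag at least `N`.
So their partial sums have second moment `O(n)` and their averages vanish almost surely
(`ae_tendsto_average_of_orthogonal`). Index shifts cost `O(1/n)`, so the averages of `f(X_k)` are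
eventually within `3ε` of `π(f)`. -/

lemma integrable_of_abs_le {Ω : Type*} [MeasurableSpace Ω] {μ : Measure Ω} [IsFiniteMeasure μ]
    {f : Ω → ℝ} (hf : Measurable f) {C : ℝ} (hC : ∀ ω, |f ω| ≤ C) : Integrable f μ :=
  Integrable.of_bound hf.aestronglyMeasurable C (.of_forall hC)

lemma abs_integral_le_of_abs_le {Ω : Type*} [MeasurableSpace Ω] {μ : Measure Ω}
    [IsProbabilityMeasure μ] {f : Ω → ℝ} {C : ℝ} (hC : ∀ ω, |f ω| ≤ C) : |∫ ω, f ω ∂μ| ≤ C := by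
  simpa using norm_integral_le_of_norm_le_const (μ := μ) (f := f) (C := C) (.of_forall hC)

/-! ### Markov property and conditional expectations along the chain -/

section Chain

variable {Z : Type*} [MeasurableSpace Z] {μ : Measure Z} [IsProbabilityMeasure μ]
  (K : ℕ → Kernel Z Z) [∀ n, IsMarkovKernel (K n)]

instance : IsProbabilityMeasure (chainLaw μ K) := by
  unfold chainLaw; infer_instance

/-- The Markov property: integrating out the state at time `n + 1` given the history. -/
lemma integral_chainLaw_succ (n : ℕ) {G : (Π _ : Finset.Iic n, Z) × Z → ℝ} (hG : Measurable G)
    {C : ℝ} (hC : ∀ p, |G p| ≤ C) :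
    ∫ ω, G (Preorder.frestrictLe (π := fun _ => Z) n ω, ω (n + 1)) ∂(chainLaw μ K) =
      ∫ ω, ∫ z, G (Preorder.frestrictLe (π := fun _ => Z) n ω, z) ∂(K n (ω n))
        ∂(chainLaw μ K) := by
  have key := Kernel.map_frestrictLe_trajMeasure_compProd_eq_map_trajMeasure (X := fun _ => Z)
    (κ := fun n => historyKernel (K n) n) (μ₀ := μ) (a := n)
  change (chainLaw μ K).map _ ⊗ₘ _ = (chainLaw μ K).map _ at key
  have hr : Measurable (Preorder.frestrictLe (π := fun _ => Z) n) := by fun_prop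
  have := Measure.isProbabilityMeasure_map (μ := chainLaw μ K) hr.aemeasurable
  rw [← integral_map (μ := chainLaw μ K)
    (φ := fun ω => (Preorder.frestrictLe (π := fun _ => Z) n ω, ω (n + 1))) (by fun_prop)
    hG.aestronglyMeasurable, ← key, Measure.integral_compProd (integrable_of_abs_le hG hC),
    integral_map hr.aemeasurable]
  · rfl
  · exact (hG.stronglyMeasurable.integral_kernel_prod_right').aestronglyMeasurable

omit [IsProbabilityMeasure μ] in
lemma map_zero_chainLaw : (chainLaw μ K).map (fun ω => ω 0) = μ := by
  have h : (chainLaw μ K).map (Preorder.frestrictLe (π := fun _ => Z) 0) =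
      μ.map (MeasurableEquiv.piUnique (fun _ : Finset.Iic 0 => Z)).symm := by
    unfold chainLaw Kernel.trajMeasure
    rw [Measure.map_comp _ _ (by fun_prop), Kernel.traj_map_frestrictLe, Kernel.partialTraj_self,
      Measure.id_comp]
  have h2 : (fun ω : ℕ → Z => ω 0) =
      (fun h : (Π _ : Finset.Iic 0, Z) => h ⟨0, by simp⟩) ∘
        (Preorder.frestrictLe (π := fun _ => Z) 0) := rfl
  rw [h2, ← Measure.map_map (by fun_prop) (by fun_prop), h,
    Measure.map_map (by fun_prop) (by fun_prop)]
  exact Measure.map_id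

/-- The expectation of `g` at time `l + N` for the chain started at time `l` in `z`. -/
noncomputable def expectAfter (g : Z → ℝ) : ℕ → ℕ → Z → ℝ
  | 0, _, z => g z
  | N + 1, l, z => ∫ z', expectAfter g N (l + 1) z' ∂(K l z)

variable {g : Z → ℝ} {C : ℝ}

omit [∀ n, IsMarkovKernel (K n)] in
lemma measurable_expectAfter (hg : Measurable g) (N l : ℕ) :
    Measurable (expectAfter K g N l) := by
  induction N generalizing l with
  | zero => exact hg
  | succ N ih => exact ((ih (l + 1)).stronglyMeasurable.integral_kernel).measurable

lemma abs_expectAfter_le (hC : ∀ z, |g z| ≤ C) (N l : ℕ) (z : Z) :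
    |expectAfter K g N l z| ≤ C := by
  induction N generalizing l z with
  | zero => exact hC z
  | succ N ih => exact abs_integral_le_of_abs_le (ih (l + 1))

omit [∀ n, IsMarkovKernel (K n)] in
lemma expectAfter_shift (N l m : ℕ) (z : Z) :
    expectAfter (fun m => K (l + m)) g N m z = expectAfter K g N (l + m) z := by
  induction N generalizing m z with
  | zero => rfl
  | succ N ih => simp only [expectAfter, ih]; rfl

/-- Identifies `expectAfter K g N k` at the current state as the conditional expectation of `g` at
time `k + N` given the history up to `k`. The induction treats a function of the history up to `k`
as one of the history up to `k + 1`, then integrates out the state at time `k + 1`. -/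
lemma integral_mul_expectAfter (hg : Measurable g) (hC : ∀ z, |g z| ≤ C) (N k : ℕ)
    {h : (Π _ : Finset.Iic k, Z) → ℝ} (hh : Measurable h) {B : ℝ} (hB : ∀ p, |h p| ≤ B) :
    ∫ ω, h (Preorder.frestrictLe (π := fun _ => Z) k ω) * g (ω (k + N)) ∂(chainLaw μ K) =
      ∫ ω, h (Preorder.frestrictLe (π := fun _ => Z) k ω) * expectAfter K g N k (ω k)
        ∂(chainLaw μ K) := by
  induction N generalizing k with
  | zero => rfl
  | succ N ih =>
    have h1 := ih (k + 1)
      (h := h ∘ Preorder.frestrictLe₂ (π := fun _ => Z) (Nat.le_succ k))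
      (hh.comp (measurable_pi_lambda _ fun _ => measurable_pi_apply _)) (fun p => hB _)
    have h2 := integral_chainLaw_succ (μ := μ) K k
      (G := fun p => h p.1 * expectAfter K g N (k + 1) p.2) (C := B * C)
      ((hh.comp measurable_fst).mul ((measurable_expectAfter K hg N (k + 1)).comp measurable_snd))
      (fun p => by
        rw [abs_mul]
        exact mul_le_mul (hB _) (abs_expectAfter_le K hC _ _ _) (abs_nonneg _)
          ((abs_nonneg _).trans (hB p.1)))
    have e : k + (N + 1) = k + 1 + N := by omega
    rw [e]
    refine h1.trans (h2.trans ?_)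
    simp only [integral_const_mul]
    rfl

lemma integral_chainLaw_dirac (hg : Measurable g) (hC : ∀ z, |g z| ≤ C) (N : ℕ) (z : Z) :
    ∫ ω, g (ω N) ∂(chainLaw (Measure.dirac z) K) = expectAfter K g N 0 z := by
  have h1 := integral_mul_expectAfter (μ := Measure.dirac z) K hg hC N 0
    (h := fun _ => 1) measurable_const (B := 1) (by simp)
  simp only [one_mul, zero_add] at h1
  have hm := measurable_expectAfter K hg N 0
  rw [h1, ← integral_map (φ := fun ω : ℕ → Z => ω 0) (measurable_pi_apply 0).aemeasurable
    hm.aestronglyMeasurable,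
    map_zero_chainLaw, integral_dirac' _ _ hm.stronglyMeasurable]

end Chain

/-! ### Law of large numbers under finite-range orthogonality -/

/-- Each row of the matrix of mixed moments has at most `2N` nonzero entries, each at most `C ^ 2`.
-/
lemma integral_sq_sum_le {Ω : Type*} [MeasurableSpace Ω] {μ : Measure Ω}
    [IsProbabilityMeasure μ] {Y : ℕ → Ω → ℝ} (hY : ∀ k, Measurable (Y k)) {C : ℝ}
    (hC : ∀ k ω, |Y k ω| ≤ C) {N : ℕ}
    (horth : ∀ j k, j + N ≤ k → ∫ ω, Y j ω * Y k ω ∂μ = 0) (n : ℕ) :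
    ∫ ω, (∑ k ∈ Finset.range n, Y k ω) ^ 2 ∂μ ≤ n * (2 * N * C ^ 2) := by
  have hb : ∀ j k ω, |Y j ω * Y k ω| ≤ C ^ 2 := fun j k ω => by
    rw [abs_mul, sq]
    exact mul_le_mul (hC _ _) (hC _ _) (abs_nonneg _) ((abs_nonneg _).trans (hC j ω))
  have hint : ∀ j k, Integrable (fun ω => Y j ω * Y k ω) μ := fun j k =>
    integrable_of_abs_le ((hY j).mul (hY k)) (hb j k)
  simp_rw [sq, Finset.sum_mul_sum]
  rw [integral_finsetSum _ fun j _ => integrable_finsetSum _ fun k _ => hint j k]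
  simp_rw [integral_finsetSum _ fun k _ => hint _ k]
  have hrow : ∀ j, ∑ k ∈ Finset.range n, ∫ ω, Y j ω * Y k ω ∂μ ≤ 2 * N * (C * C) := by
    intro j
    -- The interval contains every `k` with `|j - k| < N`; truncated subtraction only cuts it at
    -- `0`.
    have h0 : ∀ k, ∫ ω, Y j ω * Y k ω ∂μ ≤ if k ∈ Finset.Ico (j + 1 - N) (j + N) then C ^ 2 else 0 := by
      intro k
      split_ifs with hk
      · exact (le_abs_self _).trans (abs_integral_le_of_abs_le (hb j k))
      · rw [Finset.mem_Ico] at hk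
        by_cases h : j + N ≤ k
        · exact (horth j k h).le
        · simp_rw [mul_comm (Y j _)]
          exact (horth k j (by omega)).le
    calc _ ≤ ∑ k ∈ Finset.range n, if k ∈ Finset.Ico (j + 1 - N) (j + N) then C ^ 2 else 0 :=
          Finset.sum_le_sum fun k _ => h0 k
      _ = (Finset.range n ∩ Finset.Ico (j + 1 - N) (j + N)).card * C ^ 2 := by
          rw [Finset.sum_ite_mem, Finset.sum_const, nsmul_eq_mul]
      _ ≤ (2 * N : ℕ) * C ^ 2 := by
          gcongr
          refine (Finset.card_le_card Finset.inter_subset_right).trans ?_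
          rw [Nat.card_Ico]; omega
      _ = 2 * N * (C * C) := by push_cast; ring
  calc _ ≤ ∑ j ∈ Finset.range n, 2 * N * (C * C) := Finset.sum_le_sum fun j _ => hrow j
    _ = _ := by simp

/-- Averages of a bounded sequence converge to zero if they do along the squares. -/
lemma tendsto_average_of_tendsto_average_sq {y : ℕ → ℝ} {C : ℝ} (hC : ∀ k, |y k| ≤ C)
    (h : Tendsto (fun m : ℕ => ((m : ℝ) ^ 2)⁻¹ * ∑ k ∈ Finset.range (m ^ 2), y k) atTop (𝓝 0)) :
    Tendsto (fun n : ℕ => (n : ℝ)⁻¹ * ∑ k ∈ Finset.range n, y k) atTop (𝓝 0) := by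
  have hC0 : 0 ≤ C := (abs_nonneg _).trans (hC 0)
  have hs : Tendsto Nat.sqrt atTop atTop :=
    tendsto_atTop_mono' _ .rfl <| tendsto_atTop_atTop.2 fun b =>
      ⟨b * b, fun n hn => Nat.le_sqrt.2 hn⟩
  have hlim : Tendsto (fun m : ℕ => |((m : ℝ) ^ 2)⁻¹ * ∑ k ∈ Finset.range (m ^ 2), y k| +
      2 * C * (m : ℝ)⁻¹) atTop (𝓝 0) := by
    simpa using h.abs.add (tendsto_inv_atTop_nhds_zero_nat.const_mul (2 * C))
  refine squeeze_zero_norm' ?_ (hlim.comp hs)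
  filter_upwards [eventually_ge_atTop 1] with n hn
  simp only [Function.comp]
  set m := Nat.sqrt n with hm
  have hm1 : 1 ≤ m := Nat.le_sqrt.2 (by omega)
  have hmn : m ^ 2 ≤ n := Nat.sqrt_le' n
  have hnm : n ≤ m ^ 2 + 2 * m := by
    have := Nat.sqrt_le_add n
    rw [← hm] at this; nlinarith
  have hsum : |∑ k ∈ Finset.range n, y k| ≤ |∑ k ∈ Finset.range (m ^ 2), y k| + 2 * m * C := by
    rw [← Finset.sum_range_add_sum_Ico _ hmn]
    refine (abs_add_le _ _).trans ?_
    gcongr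
    refine (Finset.abs_sum_le_sum_abs _ _).trans ?_
    refine (Finset.sum_le_sum fun k _ => hC k).trans ?_
    rw [Finset.sum_const, Nat.card_Ico, nsmul_eq_mul]
    gcongr
    exact_mod_cast (by omega : n - m ^ 2 ≤ 2 * m)
  have hm0 : (0 : ℝ) < m := by exact_mod_cast hm1
  have hmn' : (m : ℝ) ^ 2 ≤ n := by exact_mod_cast hmn
  rw [Real.norm_eq_abs, abs_mul, abs_mul, abs_of_nonneg (by positivity : (0 : ℝ) ≤ (n : ℝ)⁻¹),
    abs_of_nonneg (by positivity : (0 : ℝ) ≤ ((m : ℝ) ^ 2)⁻¹)]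
  calc (n : ℝ)⁻¹ * |∑ k ∈ Finset.range n, y k|
      ≤ ((m : ℝ) ^ 2)⁻¹ * (|∑ k ∈ Finset.range (m ^ 2), y k| + 2 * m * C) := by gcongr
    _ = _ := by field_simp

/-- A strong law of large numbers for bounded sequences with finite range of correlation. -/
lemma ae_tendsto_average_of_orthogonal {Ω : Type*} [MeasurableSpace Ω] {μ : Measure Ω}
    [IsProbabilityMeasure μ] {Y : ℕ → Ω → ℝ} (hY : ∀ k, Measurable (Y k)) {C : ℝ}
    (hC : ∀ k ω, |Y k ω| ≤ C) {N : ℕ}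
    (horth : ∀ j k, j + N ≤ k → ∫ ω, Y j ω * Y k ω ∂μ = 0) :
    ∀ᵐ ω ∂μ, Tendsto (fun n : ℕ => (n : ℝ)⁻¹ * ∑ k ∈ Finset.range n, Y k ω) atTop (𝓝 0) := by
  set A : ℕ → Ω → ℝ := fun m ω => ((m : ℝ) ^ 2)⁻¹ * ∑ k ∈ Finset.range (m ^ 2), Y k ω with hA
  have hAm : ∀ m, Measurable (A m) := fun m =>
    (Finset.measurable_fun_sum _ fun k _ => hY k).const_mul _
  have hAC : ∀ m ω, |A m ω| ≤ C := by
    intro m ω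
    have hC0 : 0 ≤ C := (abs_nonneg _).trans (hC 0 ω)
    rw [hA, abs_mul, abs_of_nonneg (by positivity : (0 : ℝ) ≤ ((m : ℝ) ^ 2)⁻¹)]
    refine (mul_le_mul_of_nonneg_left ((Finset.abs_sum_le_sum_abs _ _).trans
      (Finset.sum_le_sum fun k _ => hC k ω)) (by positivity)).trans ?_
    rw [Finset.sum_const, Finset.card_range, nsmul_eq_mul, ← mul_assoc]
    push_cast
    exact mul_le_of_le_one_left hC0 (inv_mul_le_one)
  have hint : ∀ m, ∫ ω, A m ω ^ 2 ∂μ ≤ 2 * N * C ^ 2 * ((m : ℝ) ^ 2)⁻¹ := by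
    intro m
    simp only [hA, mul_pow, integral_const_mul]
    refine (mul_le_mul_of_nonneg_left (integral_sq_sum_le hY hC horth (m ^ 2))
      (by positivity)).trans (le_of_eq ?_)
    rcases Nat.eq_zero_or_pos m with rfl | hm
    · simp
    · have : (m : ℝ) ≠ 0 := by positivity
      push_cast; field_simp
  -- Along squares the second moments are `O(1/m²)`, hence summable, so `∑ A m ω ^ 2` is almost
  -- surely finite and its terms tend to zero.
  have hsum : ∑' m, ∫⁻ ω, ENNReal.ofReal (A m ω ^ 2) ∂μ ≠ ∞ := by
    have hs : Summable fun m : ℕ => 2 * N * C ^ 2 * ((m : ℝ) ^ 2)⁻¹ :=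
      (Real.summable_nat_pow_inv.2 one_lt_two).mul_left _
    refine ne_top_of_le_ne_top hs.tsum_ofReal_ne_top (ENNReal.tsum_le_tsum fun m => ?_)
    rw [← ofReal_integral_eq_lintegral_ofReal _ (.of_forall fun ω => sq_nonneg _)]
    · exact ENNReal.ofReal_le_ofReal (hint m)
    · refine integrable_of_abs_le ((hAm m).pow_const 2) (C := C ^ 2) fun ω => ?_
      rw [abs_pow]; exact pow_le_pow_left₀ (abs_nonneg _) (hAC m ω) 2
  rw [← lintegral_tsum fun m => ((hAm m).pow_const 2).ennreal_ofReal.aemeasurable] at hsum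
  filter_upwards [ae_lt_top (Measurable.tsum fun m => ((hAm m).pow_const 2).ennreal_ofReal)
    hsum] with ω hω
  refine tendsto_average_of_tendsto_average_sq (fun k => hC k ω) ?_
  have h0 := ENNReal.tendsto_atTop_zero_of_tsum_ne_top hω.ne
  have h1 : Tendsto (fun m => A m ω ^ 2) atTop (𝓝 0) := by
    have := (ENNReal.tendsto_toReal ENNReal.zero_ne_top).comp h0
    simpa [Function.comp_def, ENNReal.toReal_ofReal, sq_nonneg] using this
  have h2 : Tendsto (fun m => |A m ω|) atTop (𝓝 0) := by
    simpa only [Real.sqrt_sq_eq_abs, Real.sqrt_zero] using h1.sqrt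
  exact (tendsto_zero_iff_abs_tendsto_zero _).2 h2

/-- Each unit shift exchanges one boundary term for another, at cost at most `2C`. -/
lemma abs_sum_shift_sub_sum_le {a : ℕ → ℝ} {C : ℝ} (hC : ∀ k, |a k| ≤ C) (n N : ℕ) :
    |∑ k ∈ Finset.range n, a (k + N) - ∑ k ∈ Finset.range n, a k| ≤ 2 * N * C := by
  induction N with
  | zero => simp
  | succ N ih =>
    have h1 : ∑ k ∈ Finset.range n, a (k + (N + 1)) =
        ∑ k ∈ Finset.range n, a (k + N) + a (n + N) - a N := by
      have h2 := Finset.sum_range_succ (fun k => a (k + N)) n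
      have h3 := Finset.sum_range_succ' (fun k => a (k + N)) n
      simp only [zero_add, show ∀ k, k + 1 + N = k + (N + 1) from fun k => by omega] at h3
      linarith
    have h4 := abs_le.1 (hC (n + N))
    have h5 := abs_le.1 (hC N)
    rw [h1]
    push_cast
    rw [abs_le] at ih ⊢
    constructor <;> nlinarith

lemma abs_integral_sub_le_of_tvNorm_le {T : Type*} [MeasurableSpace T] {μ ν : Measure T}
    {e : ℝ} (he : 0 ≤ e) (h : tvNorm μ ν ≤ ENNReal.ofReal e) {f : T → ℝ} (hf : Measurable f)
    (hf1 : ∀ x, |f x| ≤ 1) : |∫ x, f x ∂μ - ∫ x, f x ∂ν| ≤ e := by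
  have h1 : ENNReal.ofReal |∫ x, f x ∂μ - ∫ x, f x ∂ν| ≤ tvNorm μ ν :=
    le_iSup_of_le f (le_iSup_of_le hf (le_iSup_of_le hf1 le_rfl))
  exact (ENNReal.ofReal_le_ofReal_iff he).1 (h1.trans h)

/-! ### Comparison with the chain of frozen parameter -/

section Adaptive

variable {X Θ : Type*} [MeasurableSpace X] [MeasurableSpace Θ]

/-- The expectation of `f` after `j` steps with transition `Q (·, θ)` at frozen parameter `θ`. -/
noncomputable def frozenExpect (Q : Kernel (X × Θ) X) (f : X → ℝ) : ℕ → X × Θ → ℝ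
  | 0, z => f z.1
  | j + 1, z => ∫ x, frozenExpect Q f j (x, z.2) ∂(Q z)

/-- The parameter in the integrand is kept apart from the one driving the transition, so that both
the adaptive step and the frozen step are covered. -/
lemma measurable_integral_frozen (Q : Kernel (X × Θ) X) [IsMarkovKernel Q] {ψ : X × Θ → ℝ}
    (hψ : Measurable ψ) : Measurable fun p : (X × Θ) × Θ => ∫ x, ψ (x, p.2) ∂(Q p.1) := by
  have h : Measurable fun q : ((X × Θ) × Θ) × X => ψ (q.2, q.1.2) := by fun_prop
  exact (h.stronglyMeasurable.integral_kernel_prod_right'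
    (κ := Q.comap Prod.fst measurable_fst)).measurable

variable {Q : Kernel (X × Θ) X} [IsMarkovKernel Q] {f : X → ℝ}

lemma measurable_frozenExpect (hf : Measurable f) (j : ℕ) : Measurable (frozenExpect Q f j) := by
  induction j with
  | zero => exact hf.comp measurable_fst
  | succ j ih =>
    exact (measurable_integral_frozen Q ih).comp (measurable_id.prodMk measurable_snd)

lemma abs_frozenExpect_le {C : ℝ} (hC : ∀ x, |f x| ≤ C) (j : ℕ) (z : X × Θ) :
    |frozenExpect Q f j z| ≤ C := by
  induction j generalizing z with
  | zero => exact hC z.1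
  | succ j ih => exact abs_integral_le_of_abs_le fun x => ih (x, z.2)

variable {P : Θ → Kernel X X} [∀ θ, IsMarkovKernel (P θ)]

omit [IsMarkovKernel Q] in
lemma frozenExpect_eq (hQ : ∀ z, Q z = P z.2 z.1) (hf : Measurable f) {C : ℝ}
    (hC : ∀ x, |f x| ≤ C) (j : ℕ) (x : X) (θ : Θ) :
    frozenExpect Q f j (x, θ) = ∫ y, f y ∂((P θ ^ j) x) := by
  induction j generalizing x with
  | zero =>
    rw [pow_zero]
    change f x = ∫ y, f y ∂(Kernel.id x)
    rw [Kernel.id_apply, integral_dirac' _ _ hf.stronglyMeasurable]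
  | succ j ih =>
    have hm : ∀ j : ℕ, IsMarkovKernel (P θ ^ j) := fun j => by
      induction j with
      | zero => rw [pow_zero]; exact inferInstanceAs (IsMarkovKernel Kernel.id)
      | succ j ih => rw [pow_succ]; exact inferInstanceAs (IsMarkovKernel ((P θ ^ j) ∘ₖ P θ))
    have := hm j
    have := hm (j + 1)
    have e : P θ ^ (j + 1) = (P θ ^ j) ∘ₖ P θ := pow_succ _ _
    rw [e] at this ⊢
    rw [Kernel.integral_comp (integrable_of_abs_le hf hC)]
    simp only [frozenExpect, ih, hQ]

variable {K : ℕ → Kernel (X × Θ) (X × Θ)} [∀ n, IsMarkovKernel (K n)]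
  {μ : Measure (X × Θ)} [IsProbabilityMeasure μ]

omit [MeasurableSpace Θ] [∀ θ, IsMarkovKernel (P θ)] in
lemma abs_integral_sub_le_of_kernelDist_lt {θ θ' : Θ} {e : ℝ} (he : 0 ≤ e)
    (h : kernelDist P θ θ' < ENNReal.ofReal e) {ψ : X → ℝ} (hψ : Measurable ψ)
    (hψ1 : ∀ x, |ψ x| ≤ 1) (x : X) : |∫ y, ψ y ∂(P θ x) - ∫ y, ψ y ∂(P θ' x)| ≤ e :=
  abs_integral_sub_le_of_tvNorm_le he ((le_iSup _ x).trans h.le) hψ hψ1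

omit [MeasurableSpace Θ] [∀ θ, IsMarkovKernel (P θ)] in
lemma abs_integral_sub_le_mul {θ : ℕ → Θ} {e : ℝ} (he : 0 ≤ e) {M : ℕ}
    (h : ∀ i < M, kernelDist P (θ (i + 1)) (θ i) < ENNReal.ofReal e) {ψ : X → ℝ}
    (hψ : Measurable ψ) (hψ1 : ∀ x, |ψ x| ≤ 1) (x : X) {j : ℕ} (hj : j ≤ M) :
    |∫ y, ψ y ∂(P (θ j) x) - ∫ y, ψ y ∂(P (θ 0) x)| ≤ j * e := by
  induction j with
  | zero => simp
  | succ j ih =>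
    have h1 := ih (by omega)
    have h2 := abs_integral_sub_le_of_kernelDist_lt he (h j (by omega)) hψ hψ1 x
    have h3 := abs_sub_le (∫ y, ψ y ∂(P (θ (j + 1)) x)) (∫ y, ψ y ∂(P (θ j) x))
      (∫ y, ψ y ∂(P (θ 0) x))
    push_cast
    linarith

/-- An integrand bounded by `2`, and by `b` off a set of small outer measure. -/
lemma abs_integral_le_add_of_off_small {Ω : Type*} [MeasurableSpace Ω] {ρ : Measure Ω}
    [IsProbabilityMeasure ρ] {V : Ω → ℝ} (hV : Measurable V) (hV2 : ∀ ω, |V ω| ≤ 2) {B : Set Ω}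
    {b δ : ℝ} (hb : 0 ≤ b) (hδ : 0 ≤ δ) (hB : ρ B ≤ ENNReal.ofReal δ) (hoff : ∀ ω ∉ B, |V ω| ≤ b) :
    |∫ ω, V ω ∂ρ| ≤ b + 2 * δ := by
  -- `B` need not be measurable, so the integral is split on its measurable hull, which has the same
  -- measure.
  have hm := measurableSet_toMeasurable ρ B
  have hle : ∀ ω, |V ω| ≤ b + (toMeasurable ρ B).indicator (fun _ => (2 : ℝ)) ω := by
    intro ω
    by_cases hω : ω ∈ toMeasurable ρ B
    · rw [Set.indicator_of_mem hω]; linarith [hV2 ω]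
    · rw [Set.indicator_of_notMem hω, add_zero]
      exact hoff ω fun h => hω (subset_toMeasurable ρ B h)
  have hi : Integrable ((toMeasurable ρ B).indicator (fun _ => (2 : ℝ))) ρ :=
    (integrable_const _).indicator hm
  refine (abs_integral_le_integral_abs).trans ((integral_mono
    (integrable_of_abs_le hV hV2).abs ((integrable_const b).add hi) hle).trans ?_)
  have hr : ρ.real (toMeasurable ρ B) ≤ δ := by
    rw [measureReal_def, measure_toMeasurable]
    exact ENNReal.toReal_le_of_le_ofReal hδ hB
  simp only [Pi.add_apply]
  rw [integral_add (integrable_const b) hi, integral_indicator_const _ hm]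
  simp only [integral_const, probReal_univ, smul_eq_mul, one_mul]
  linarith

omit [IsMarkovKernel Q] in
-- The integrand sees the new state only through its `X`-coordinate, so only the marginal `Q` of the
-- joint transition enters.
lemma integral_frozen_succ (hKQ : ∀ n z, (K n z).map Prod.fst = Q z) {ψ : X × Θ → ℝ}
    (hψ : Measurable ψ) {C : ℝ} (hC : ∀ z, |ψ z| ≤ C) (n j : ℕ) :
    ∫ ω, ψ ((ω (n + j + 1)).1, (ω n).2) ∂(chainLaw μ K) =
      ∫ ω, ∫ x, ψ (x, (ω n).2) ∂(Q (ω (n + j))) ∂(chainLaw μ K) := by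
  have h := integral_chainLaw_succ (μ := μ) K (n + j)
    (G := fun p => ψ (p.2.1, (p.1 ⟨n, by simp⟩).2)) (C := C)
    (hψ.comp ((measurable_fst.comp measurable_snd).prodMk
      (measurable_snd.comp ((measurable_pi_apply _).comp measurable_fst)))) (fun p => hC _)
  refine h.trans (integral_congr_ae (.of_forall fun ω => ?_))
  simp only [← hKQ (n + j)]
  rw [integral_map measurable_fst.aemeasurable]
  · rfl
  · exact (hψ.comp (measurable_id.prodMk measurable_const)).aestronglyMeasurable

omit [∀ θ, IsMarkovKernel (P θ)] in
/-- Freezing the parameter at time `n` changes the expectation at time `n + M` by little. -/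
lemma abs_integral_sub_frozenExpect_le (hQ : ∀ z, Q z = P z.2 z.1)
    (hKQ : ∀ n z, (K n z).map Prod.fst = Q z) (hf : Measurable f) (hf1 : ∀ x, |f x| ≤ 1)
    {e δ : ℝ} (he : 0 ≤ e) (hδ : 0 ≤ δ) (n M : ℕ)
    (hbad : ∀ i < M, chainLaw μ K
      {ω | ENNReal.ofReal e ≤ kernelDist P (ω (n + i + 1)).2 (ω (n + i)).2} ≤ ENNReal.ofReal δ) :
    |∫ ω, f (ω (n + M)).1 ∂(chainLaw μ K) - ∫ ω, frozenExpect Q f M (ω n) ∂(chainLaw μ K)| ≤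
      M * (M * e + 2 * (M * δ)) := by
  set B : Set (ℕ → X × Θ) := ⋃ i ∈ Finset.range M,
    {ω | ENNReal.ofReal e ≤ kernelDist P (ω (n + i + 1)).2 (ω (n + i)).2} with hBdef
  have hB : chainLaw μ K B ≤ ENNReal.ofReal (M * δ) := by
    refine (measure_biUnion_finset_le _ _).trans ((Finset.sum_le_sum fun i hi =>
      hbad i (Finset.mem_range.1 hi)).trans (le_of_eq ?_))
    rw [Finset.sum_const, Finset.card_range, nsmul_eq_mul, ENNReal.ofReal_mul (by positivity),
      ENNReal.ofReal_natCast]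
  -- One step driven by the parameter of time `n + j` is replaced by one driven by that of time `n`.
  -- Off `B` the kernels differ by at most `j * e ≤ M * e`; on `B` the trivial bound `2` is used.
  have hstep : ∀ j r, j ≤ M →
      |∫ ω, frozenExpect Q f r ((ω (n + j + 1)).1, (ω n).2) ∂(chainLaw μ K) -
        ∫ ω, frozenExpect Q f (r + 1) ((ω (n + j)).1, (ω n).2) ∂(chainLaw μ K)| ≤
      M * e + 2 * (M * δ) := by
    intro j r hj
    have hψ := measurable_frozenExpect (Q := Q) hf r
    have hψ1 := abs_frozenExpect_le (Q := Q) hf1 r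
    have hU := measurable_integral_frozen Q hψ
    have hm1 : Measurable fun ω : ℕ → X × Θ =>
        ∫ x, frozenExpect Q f r (x, (ω n).2) ∂(Q (ω (n + j))) :=
      hU.comp (f := fun ω : ℕ → X × Θ => (ω (n + j), (ω n).2))
        ((measurable_pi_apply (n + j)).prodMk (measurable_snd.comp (measurable_pi_apply n)))
    have hm2 : Measurable fun ω : ℕ → X × Θ =>
        ∫ x, frozenExpect Q f r (x, (ω n).2) ∂(Q ((ω (n + j)).1, (ω n).2)) :=
      hU.comp (f := fun ω : ℕ → X × Θ => (((ω (n + j)).1, (ω n).2), (ω n).2))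
        (((measurable_fst.comp (measurable_pi_apply (n + j))).prodMk
        (measurable_snd.comp (measurable_pi_apply n))).prodMk
        (measurable_snd.comp (measurable_pi_apply n)))
    have hb : ∀ (z : X × Θ) (θ : Θ), |∫ x, frozenExpect Q f r (x, θ) ∂(Q z)| ≤ 1 :=
      fun z θ => abs_integral_le_of_abs_le fun x => hψ1 _
    rw [integral_frozen_succ hKQ hψ hψ1]
    simp only [frozenExpect]
    rw [← integral_sub (integrable_of_abs_le hm1 fun ω => hb _ _)
      (integrable_of_abs_le hm2 fun ω => hb _ _)]
    refine abs_integral_le_add_of_off_small (hm1.sub hm2) (fun ω => ?_) (B := B) (by positivity)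
      (by positivity) hB fun ω hω => ?_
    · refine (abs_sub _ _).trans ?_
      linarith [hb (ω (n + j)) (ω n).2, hb ((ω (n + j)).1, (ω n).2) (ω n).2]
    · have hω' : ∀ i < M, kernelDist P (ω (n + (i + 1))).2 (ω (n + i)).2 < ENNReal.ofReal e := by
        intro i hi
        by_contra hcon
        exact hω (Set.mem_biUnion (Finset.mem_coe.2 (Finset.mem_range.2 hi)) (not_lt.1 hcon))
      have := abs_integral_sub_le_mul (P := P) (θ := fun i => (ω (n + i)).2) he hω'
        (ψ := fun x => frozenExpect Q f r (x, (ω n).2))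
        (hψ.comp (measurable_id.prodMk measurable_const)) (fun x => hψ1 _) (ω (n + j)).1 hj
      simp only [hQ]
      refine this.trans ?_
      gcongr
  -- Interpolate: `j` genuine steps, then `M - j` frozen ones. Consecutive interpolants differ by
  -- one use of `hstep`.
  have htel : ∀ j ≤ M,
      |∫ ω, frozenExpect Q f (M - j) ((ω (n + j)).1, (ω n).2) ∂(chainLaw μ K) -
        ∫ ω, frozenExpect Q f M (ω n) ∂(chainLaw μ K)| ≤ j * (M * e + 2 * (M * δ)) := by
    intro j hj
    induction j with
    | zero => simp
    | succ j ih =>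
      have h1 := ih (by omega)
      have h2 := hstep j (M - (j + 1)) (by omega)
      rw [show M - (j + 1) + 1 = M - j by omega] at h2
      have h3 := abs_sub_le
        (∫ ω, frozenExpect Q f (M - (j + 1)) ((ω (n + j + 1)).1, (ω n).2) ∂(chainLaw μ K))
        (∫ ω, frozenExpect Q f (M - j) ((ω (n + j)).1, (ω n).2) ∂(chainLaw μ K))
        (∫ ω, frozenExpect Q f M (ω n) ∂(chainLaw μ K))
      push_cast
      rw [← add_assoc n j 1]
      linarith
  have := htel M le_rfl
  rw [Nat.sub_self] at this
  exact this

/-- The marginal laws of the adaptive chain converge to `π`, uniformly in the starting point. -/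
lemma exists_abs_expectAfter_sub_le (hQ : ∀ z, Q z = P z.2 z.1)
    (hKQ : ∀ n z, (K n z).map Prod.fst = Q z) {π : Measure X}
    (herg : Tendsto (fun n : ℕ => ⨆ (x : X) (θ : Θ), tvNorm ((P θ ^ n) x) π) atTop (𝓝 0))
    (hdim : ∀ ε : ℝ, 0 < ε →
      Tendsto (fun n : ℕ => ⨆ (l : ℕ) (x : X) (θ : Θ),
        chainLaw (Measure.dirac (x, θ)) (fun m => K (l + m))
          {ω | ENNReal.ofReal ε ≤ kernelDist P (ω (n + 1)).2 (ω n).2}) atTop (𝓝 0))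
    (hf : Measurable f) (hf1 : ∀ x, |f x| ≤ 1) {ε : ℝ} (hε : 0 < ε) :
    ∃ N, ∀ l z, |expectAfter K (fun z => f z.1) N l z - ∫ x, f x ∂π| ≤ ε := by
  obtain ⟨M, hM⟩ := (herg.eventually_le_const
    (ENNReal.ofReal_pos.2 (half_pos hε))).exists
  -- `e` serves as both threshold and probability bound, for a freezing error `3 * M ^ 2 * e ≤ ε /
  -- 2`. It depends on `M`, so `M` is fixed first and the waiting time `n` last.
  set e : ℝ := ε / (6 * (M ^ 2 + 1)) with he_def
  have he : 0 < e := by positivity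
  obtain ⟨n, hn⟩ := eventually_atTop.1
    ((hdim e he).eventually_le_const (ENNReal.ofReal_pos.2 he))
  refine ⟨n + M, fun l ⟨x₀, θ₀⟩ => ?_⟩
  have h1 := abs_integral_sub_frozenExpect_le (μ := Measure.dirac (x₀, θ₀)) (K := fun m => K (l + m))
    hQ (fun m z => hKQ (l + m) z) hf hf1 he.le he.le n M fun i _ =>
      (le_iSup_of_le l (le_iSup_of_le x₀ (le_iSup (fun θ =>
        chainLaw (Measure.dirac (x₀, θ)) (fun m => K (l + m)) {ω | ENNReal.ofReal e ≤
          kernelDist P (ω (n + i + 1)).2 (ω (n + i)).2}) θ₀))).trans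
        (hn (n + i) (by omega))
  rw [integral_chainLaw_dirac (fun m => K (l + m)) (g := fun z => f z.1) (hf.comp measurable_fst)
    (fun z => hf1 z.1), expectAfter_shift, add_zero] at h1
  have hF := measurable_frozenExpect (Q := Q) hf M
  have h2 : |∫ ω, frozenExpect Q f M (ω n) ∂(chainLaw (Measure.dirac (x₀, θ₀)) fun m => K (l + m)) -
      ∫ x, f x ∂π| ≤ ε / 2 := by
    have hpt : ∀ z, |frozenExpect Q f M z - ∫ x, f x ∂π| ≤ ε / 2 := by
      rintro ⟨x, θ⟩
      rw [frozenExpect_eq hQ hf hf1]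
      exact abs_integral_sub_le_of_tvNorm_le (half_pos hε).le
        ((le_iSup_of_le x (le_iSup (fun θ => tvNorm ((P θ ^ M) x) π) θ)).trans hM) hf hf1
    have := abs_integral_le_of_abs_le
      (μ := chainLaw (Measure.dirac (x₀, θ₀)) fun m => K (l + m)) fun ω => hpt (ω n)
    have hFn : Measurable fun ω : ℕ → X × Θ => frozenExpect Q f M (ω n) :=
      hF.comp (f := fun ω : ℕ → X × Θ => ω n) (measurable_pi_apply n)
    rwa [integral_sub (integrable_of_abs_le hFn fun ω => abs_frozenExpect_le hf1 _ _)
      (integrable_const _), integral_const, probReal_univ, one_smul] at this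
  have h3 : M * (M * e + 2 * (M * e)) ≤ ε / 2 := by
    have : M * (M * e + 2 * (M * e)) = (M ^ 2 / (M ^ 2 + 1)) * (ε / 2) := by
      rw [he_def]; field_simp; ring
    rw [this]
    refine mul_le_of_le_one_left (half_pos hε).le ((div_le_one (by positivity)).2 (by linarith))
  linarith [abs_sub_le (expectAfter K (fun z => f z.1) (n + M) l (x₀, θ₀))
    (∫ ω, frozenExpect Q f M (ω n) ∂(chainLaw (Measure.dirac (x₀, θ₀)) fun m => K (l + m)))
    (∫ x, f x ∂π)]

end Adaptive

/-! ### From uniform conditional means to almost sure averages -/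

lemma ae_eventually_average_sub_le {X Θ : Type*} [MeasurableSpace X] [MeasurableSpace Θ]
    (K : ℕ → Kernel (X × Θ) (X × Θ)) [∀ n, IsMarkovKernel (K n)] {μ : Measure (X × Θ)}
    [IsProbabilityMeasure μ] {f : X → ℝ} (hf : Measurable f) (hf1 : ∀ x, |f x| ≤ 1) {c ε : ℝ}
    (hε : 0 < ε) {N : ℕ}
    (hN : ∀ l z, |expectAfter K (fun z => f z.1) N l z - c| ≤ ε) :
    ∀ᵐ ω ∂(chainLaw μ K), ∀ᶠ n : ℕ in atTop,
      |(n : ℝ)⁻¹ * ∑ k ∈ Finset.Icc 1 n, f (ω k).1 - c| ≤ 3 * ε := by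
  have hg : Measurable fun z : X × Θ => f z.1 := hf.comp measurable_fst
  have hg1 : ∀ z : X × Θ, |f z.1| ≤ 1 := fun z => hf1 z.1
  have hφ := measurable_expectAfter K hg N
  have hφ1 := abs_expectAfter_le K hg1 N
  have hb : ∀ (k : ℕ) (z z' : X × Θ), |f z.1 - expectAfter K (fun z => f z.1) N k z'| ≤ 2 :=
    fun k z z' => (abs_sub _ _).trans (by linarith [hg1 z, hφ1 k z'])
  have hslln := ae_tendsto_average_of_orthogonal (μ := chainLaw μ K) (N := N) (C := 2)
    (Y := fun k ω => f (ω (k + N)).1 - expectAfter K (fun z => f z.1) N k (ω k))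
    (fun k => (hg.comp (measurable_pi_apply (k + N))).sub ((hφ k).comp (measurable_pi_apply k)))
    (fun k ω => hb k _ _) ?_
  · filter_upwards [hslln] with ω hω
    have hlim : Tendsto (fun n : ℕ => (2 * N + 2) * (n : ℝ)⁻¹) atTop (𝓝 0) := by
      simpa using tendsto_inv_atTop_nhds_zero_nat.const_mul (2 * (N : ℝ) + 2)
    -- The three `ε` are: the two index shifts, by `N` and by `1` (`h1`); the orthogonal part
    -- (`h2`); the bias of the conditional means (`hs3`).
    filter_upwards [hlim.eventually_le_const hε,
      (tendsto_zero_iff_abs_tendsto_zero _).1 hω |>.eventually_le_const hε,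
      eventually_ge_atTop 1] with n h1 h2 hn
    simp only [Function.comp] at h2
    have hn0 : (0 : ℝ) < n := by exact_mod_cast hn
    set a : ℕ → ℝ := fun k => f (ω k).1 with ha
    set b : ℕ → ℝ := fun k => expectAfter K (fun z => f z.1) N k (ω k) with hbdef
    have ha1 : ∀ k, |a k| ≤ 1 := fun k => hf1 _
    have hIcc : ∑ k ∈ Finset.Icc 1 n, a k = ∑ k ∈ Finset.range n, a (k + 1) := by
      rw [Finset.range_eq_Ico, Finset.sum_Ico_add' a 0 n 1]; rfl
    have hs1 := abs_le.1 (abs_sum_shift_sub_sum_le ha1 n 1)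
    have hs2 := abs_le.1 (abs_sum_shift_sub_sum_le ha1 n N)
    have hs3 : |∑ k ∈ Finset.range n, b k - n * c| ≤ n * ε := by
      have : ∑ k ∈ Finset.range n, b k - n * c = ∑ k ∈ Finset.range n, (b k - c) := by
        simp [Finset.sum_sub_distrib]
      rw [this]
      refine (Finset.abs_sum_le_sum_abs _ _).trans
        ((Finset.sum_le_sum fun k _ => hN k (ω k)).trans (by simp))
    rw [Finset.sum_sub_distrib, abs_mul, abs_of_pos (inv_pos.2 hn0), inv_mul_le_iff₀ hn0] at h2
    rw [mul_inv_le_iff₀ hn0] at h1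
    have h4 : (n : ℝ)⁻¹ * ∑ k ∈ Finset.Icc 1 n, a k - c =
        (n : ℝ)⁻¹ * (∑ k ∈ Finset.Icc 1 n, a k - n * c) := by field_simp
    rw [h4, abs_mul, abs_of_pos (inv_pos.2 hn0), inv_mul_le_iff₀ hn0, hIcc, abs_le]
    rw [abs_le] at h2 hs3
    push_cast at hs1
    constructor <;> linarith
  -- Since `j + N ≤ k`, `Y_j` is a function of the history up to `k`, against which `Y_k` integrates
  -- to zero.
  · intro j k hjk
    have h := integral_mul_expectAfter (μ := μ) K hg hg1 N k
      (h := fun p => f (p ⟨j + N, by simpa using hjk⟩).1 -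
        expectAfter K (fun z => f z.1) N j (p ⟨j, by simp; omega⟩))
      ((hg.comp (measurable_pi_apply _)).sub ((hφ j).comp (measurable_pi_apply _)))
      (fun p => hb j _ _)
    have hYm : Measurable fun ω : ℕ → X × Θ =>
        f (ω (j + N)).1 - expectAfter K (fun z => f z.1) N j (ω j) :=
      (hg.comp (measurable_pi_apply (j + N))).sub ((hφ j).comp (measurable_pi_apply j))
    have hY2 : Integrable (fun ω : ℕ → X × Θ =>
        f (ω (j + N)).1 - expectAfter K (fun z => f z.1) N j (ω j)) (chainLaw μ K) :=
      integrable_of_abs_le hYm fun ω => hb j _ _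
    simp only [mul_sub]
    rw [integral_sub]
    · exact sub_eq_zero.2 h
    · exact hY2.mul_bdd (c := 1) (hg.comp (measurable_pi_apply (k + N))).aestronglyMeasurable
        (.of_forall fun ω => hg1 _)
    · exact hY2.mul_bdd (c := 1) ((hφ k).comp (measurable_pi_apply k)).aestronglyMeasurable
        (.of_forall fun ω => hφ1 k _)

end AdaptiveChain

theorem proposition2p6 {X Θ : Type*}
    [MeasurableSpace X] [MeasurableSpace.CountablyGenerated X]
    [MeasurableSpace Θ] [MeasurableSpace.CountablyGenerated Θ]
    -- the family of transition kernels on the state space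
    (P : Θ → Kernel X X) [∀ θ, IsMarkovKernel (P θ)]
    (hP : ∀ (x : X) (A : Set X), MeasurableSet A → Measurable (fun θ => P θ x A))
    -- the transition kernels of the adaptive chain
    (K : ℕ → Kernel (X × Θ) (X × Θ)) [∀ n, IsMarkovKernel (K n)]
    (hK : ∀ (n : ℕ) (x : X) (θ : Θ) (A : Set X), MeasurableSet A →
      K n (x, θ) (A ×ˢ Set.univ) = P θ x A)
    -- uniform ergodicity
    (π : Measure X) [IsProbabilityMeasure π]
    (herg : Tendsto (fun n : ℕ => ⨆ (x : X) (θ : Θ), AdaptiveChain.tvNorm ((P θ ^ n) x) π)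
      atTop (𝓝 0))
    -- uniform diminishing adaptation
    (hdim : ∀ ε : ℝ, 0 < ε →
      Tendsto (fun n : ℕ => ⨆ (l : ℕ) (x : X) (θ : Θ),
        AdaptiveChain.chainLaw (Measure.dirac (x, θ)) (fun m => K (l + m))
          {ω | ENNReal.ofReal ε ≤ AdaptiveChain.kernelDist P (ω (n + 1)).2 (ω n).2})
        atTop (𝓝 0))
    -- the bounded function and the initial distributions
    (f : X → ℝ) (hf : Measurable f) (hfb : ∃ C : ℝ, ∀ x, |f x| ≤ C)
    (ξ₁ : Measure X) [IsProbabilityMeasure ξ₁] (ξ₂ : Measure Θ) [IsProbabilityMeasure ξ₂] :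
    ∀ᵐ ω ∂(AdaptiveChain.chainLaw (ξ₁.prod ξ₂) K),
      Tendsto (fun n : ℕ => (n : ℝ)⁻¹ * ∑ k ∈ Finset.Icc 1 n, f (ω k).1) atTop
        (𝓝 (∫ x, f x ∂π)) := by 
  obtain ⟨C, hC⟩ := hfb
  -- All the `K n` share this marginal, so `K 0` packages the family `P` as one kernel, jointly
  -- measurable in state and parameter.
  set Q : Kernel (X × Θ) X := (K 0).map Prod.fst with hQdef
  have : IsMarkovKernel Q := Kernel.IsMarkovKernel.map _ measurable_fst
  have hKP : ∀ n z, (K n z).map Prod.fst = P z.2 z.1 := by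
    rintro n ⟨x, θ⟩
    ext A hA
    rw [Measure.map_apply measurable_fst hA, ← hK n x θ A hA]
    congr 1
    ext z; simp
  have hQ : ∀ z, Q z = P z.2 z.1 := fun z => by
    rw [hQdef, Kernel.map_apply _ measurable_fst, hKP]
  have hKQ : ∀ n z, (K n z).map Prod.fst = Q z := fun n z => (hKP n z).trans (hQ z).symm
  have hne : Nonempty X := by
    by_contra h
    rw [not_nonempty_iff] at h
    exact IsProbabilityMeasure.ne_zero ξ₁ (Measure.eq_zero_of_isEmpty ξ₁)
  have hc : 0 < C + 1 := by
    obtain ⟨x⟩ := hne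
    linarith [(abs_nonneg _).trans (hC x)]
  have hg : Measurable fun x => f x / (C + 1) := hf.div_const _
  have hg1 : ∀ x, |f x / (C + 1)| ≤ 1 := fun x => by
    rw [abs_div, abs_of_pos hc, div_le_one hc]
    linarith [hC x]
  -- Countably many tolerances, so that a single null set serves them all.
  have hae : ∀ᵐ ω ∂(AdaptiveChain.chainLaw (ξ₁.prod ξ₂) K), ∀ i : ℕ, ∀ᶠ n : ℕ in atTop,
      |(n : ℝ)⁻¹ * ∑ k ∈ Finset.Icc 1 n, f (ω k).1 / (C + 1) - ∫ x, f x / (C + 1) ∂π| ≤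
        3 * (1 / ((i : ℝ) + 1)) := by
    rw [ae_all_iff]
    intro i
    obtain ⟨N, hN⟩ := AdaptiveChain.exists_abs_expectAfter_sub_le hQ hKQ herg hdim hg hg1
      (Nat.one_div_pos_of_nat (α := ℝ) (n := i))
    exact AdaptiveChain.ae_eventually_average_sub_le K hg hg1 Nat.one_div_pos_of_nat hN
  filter_upwards [hae] with ω hω
  have hlim : Tendsto (fun n : ℕ => (n : ℝ)⁻¹ * ∑ k ∈ Finset.Icc 1 n, f (ω k).1 / (C + 1)) atTop
      (𝓝 (∫ x, f x / (C + 1) ∂π)) := by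
    rw [Metric.tendsto_atTop']
    intro ε hε
    obtain ⟨i, hi⟩ := exists_nat_one_div_lt (div_pos hε (by norm_num : (0 : ℝ) < 3))
    obtain ⟨n₀, hn₀⟩ := eventually_atTop.1 (hω i)
    refine ⟨n₀, fun n hn => ?_⟩
    rw [Real.dist_eq]
    linarith [hn₀ n hn.le]
  have h := hlim.const_mul (C + 1)
  rw [integral_div, mul_div_cancel₀ _ hc.ne'] at h
  refine h.congr fun n => ?_
  rw [← Finset.sum_div]
  field_simp
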